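/- Let $\mathscr H$ be a complex Hilbert space and $0<p<\infty$. Let $\mathbb B_p(\mathscr H)$ be the set of compact operators $X$ on $\mathscr H$ whose singular values $s_n(X)$ satisfy $\sum_n s_n(X)^p<\infty$; write $|X|=(X^*X)^{1/2}$, and $A\le B$ if $B-A$ is positive semidefinite. Let $X_1,\dots,X_s,Y_1,\dots,Y_t\in\mathbb B_p(\mathscr H)$ satisfy $$\sum_{i=1}^s|X_i|^2=\sum_{j=1}^t|Y_j|^2 .$$ (a) If $p\ge 2$, there are partial isometries $U_1,\dots,U_s$ and $V_1,\dots,V_t$ on $\mathscr H$, each $U_i$ isometric on $(\ker X_i)^\perp$ and each $V_j$ isometric on $(\ker Y_j)^\perp$ (that is, $(\ker X_i)^\perp$ and $(\ker Y_j)^\perp$ are contained in the initial spaces of $U_i$ and $V_j$ respectively), such that $$\sum_{i=1}^sU_i|X_i|^pU_i^*\le t^{\frac p2-1}\sum_{j=1}^t|Y_j|^p,\qquad \sum_{j=1}^tV_j|Y_j|^pV_j^*\le s^{\frac p2-1}\sum_{i=1}^s|X_i|^p .$$ If $\mathscr H$ is finite-dimensional, all $U_i$ and $V_j$ can moreover be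 chosen to be isometries, i.e. unitaries. (b) If $0<p\le 2$, there are isometries $U_1,\dots,U_s$ and $V_1,\dots,V_t$ on $\mathscr H$ such that $$\sum_{i=1}^sU_i|X_i|^pU_i^*\ge t^{\frac p2-1}\sum_{j=1}^t|Y_j|^p,\qquad \sum_{j=1}^tV_j|Y_j|^pV_j^*\ge s^{\frac p2-1}\sum_{i=1}^s|X_i|^p .$$ -/

import Mathlib

noncomputable section

/-- The `n`-th singular value `s_n(X)` (indexed from `0`) of a bounded operator `X` on a Hilbert
space, as the distance from `X` to the operators of rank at most `n`. For compact `X` these are the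
eigenvalues of `|X|` in decreasing order, counted with multiplicity. -/
def opSingularValue {H : Type*} [NormedAddCommGroup H] [InnerProductSpace ℂ H]
    (X : H →L[ℂ] H) (n : ℕ) : ℝ :=
  sInf {r : ℝ | ∃ F : H →L[ℂ] H, LinearMap.rank (F : H →ₗ[ℂ] H) ≤ (n : Cardinal) ∧ r = ‖X - F‖}

/-- The Schatten class `𝔹_p(H)`, for real `p > 0`: the compact operators whose singular values
satisfy `∑ s_n(X) ^ p < ∞`. -/
def IsSchatten {H : Type*} [NormedAddCommGroup H] [InnerProductSpace ℂ H]
    (p : ℝ) (X : H →L[ℂ] H) : Prop :=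
  IsCompactOperator X ∧ Summable (fun n : ℕ => opSingularValue X n ^ p)

/-- `U` is an isometry: `U* U = 1`. -/
def IsIsometryOp {H : Type*} [NormedAddCommGroup H] [InnerProductSpace ℂ H] [CompleteSpace H]
    (U : H →L[ℂ] H) : Prop :=
  star U * U = 1

/-- `U` is a partial isometry, `U U* U = U`, i.e. it is isometric on its initial space
`(ker U)ᗮ`. -/
def IsPartialIsometryOp {H : Type*} [NormedAddCommGroup H] [InnerProductSpace ℂ H]
    [CompleteSpace H] (U : H →L[ℂ] H) : Prop :=
  U * star U * U = U

/-- `U` is a partial isometry which is isometric on the support `(ker X)ᗮ` of `X`: its initial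
space `(ker U)ᗮ` contains `(ker X)ᗮ`. On a finite-dimensional space `U` is moreover required to be
isometric everywhere, hence unitary. -/
def IsIsometricOnSupport {H : Type*} [NormedAddCommGroup H] [InnerProductSpace ℂ H]
    [CompleteSpace H] (U X : H →L[ℂ] H) : Prop :=
  IsPartialIsometryOp U ∧
    LinearMap.ker (U : H →ₗ[ℂ] H) ≤ LinearMap.ker (X : H →ₗ[ℂ] H) ∧
    (FiniteDimensional ℂ H → IsIsometryOp U)

/-- `|X| ^ p`, where `|X| = (X* X) ^ (1/2)`, by continuous functional calculus. -/
def absPow {H : Type*} [NormedAddCommGroup H] [InnerProductSpace ℂ H] [CompleteSpace H]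
    (X : H →L[ℂ] H) (p : ℝ) : H →L[ℂ] H :=
  CFC.abs X ^ p

end

/-
Put `A i = |X i|²` and `S = ∑ i, A i`. Douglas factorization writes `√(A i) = C i * √S` with
contractions `C i`, and `∑ i, (C i)* (C i)` is the projection onto the support of `S`. With
`R i = C i * S ^ (p / 2 / 2)` this gives `S ^ (p / 2) = ∑ i, (R i)* (R i)`, whose summands are
conjugate, through the polar decomposition of `R i`, to `R i (R i)* = C i * S ^ (p / 2) * (C i)*`.
These are compared with `(A i) ^ (p / 2) = (C i * S * (C i)*) ^ (p / 2)`.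

For `p ≤ 2`, Hansen's inequality gives `C i * S ^ (p / 2) * (C i)* ≤ (A i) ^ (p / 2)`, and the polar
factors extend to isometries. Operator concavity of `x ↦ x ^ (p / 2)` bounds the power of
`S = ∑ j, |Y j|²` from below.

For `p ≥ 2` only Jensen's inequality for a single vector, `⟪B x, x⟫ ^ r ≤ ⟪B ^ r x, x⟫`, is
available. For compact operators, a bound `⟪B x, x⟫ ^ r ≤ ⟪M x, x⟫` on the unit sphere still orders
the eigenvalues of `B ^ r` below those of `M` by the min-max principle; Hall's marriage theorem
matches the eigenvectors injectively, and the matching is a partial isometry that carries `B ^ r`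
below `M`.
-/

open ContinuousLinearMap

section QuadraticForm

variable {H : Type*} [NormedAddCommGroup H] [InnerProductSpace ℂ H]

theorem mul_eq_zero_of_ker_le {A B Z : H →L[ℂ] H} (h : A.ker ≤ B.ker) (hZ : A * Z = 0) :
    B * Z = 0 := by
  ext x
  exact h congr($hZ x)

theorem reApplyInnerSelf_add (A B : H →L[ℂ] H) (x : H) :
    (A + B).reApplyInnerSelf x = A.reApplyInnerSelf x + B.reApplyInnerSelf x := by
  simp [reApplyInnerSelf_apply, inner_add_left]

theorem reApplyInnerSelf_sum {ι : Type*} (s : Finset ι) (A : ι → H →L[ℂ] H) (x : H) :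
    (∑ i ∈ s, A i).reApplyInnerSelf x = ∑ i ∈ s, (A i).reApplyInnerSelf x := by
  simp [reApplyInnerSelf_apply, sum_inner]

theorem reApplyInnerSelf_real_smul (c : ℝ) (A : H →L[ℂ] H) (x : H) :
    (c • A).reApplyInnerSelf x = c * A.reApplyInnerSelf x := by
  simp [reApplyInnerSelf_apply, inner_smul_left_eq_smul]

theorem reApplyInnerSelf_one (x : H) : (1 : H →L[ℂ] H).reApplyInnerSelf x = ‖x‖ ^ 2 := by
  simp [reApplyInnerSelf_apply, ← Complex.ofReal_pow]

theorem reApplyInnerSelf_mono {A B : H →L[ℂ] H} (h : A ≤ B) (x : H) :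
    A.reApplyInnerSelf x ≤ B.reApplyInnerSelf x := by
  simpa [reApplyInnerSelf_apply, inner_sub_left] using
    ((ContinuousLinearMap.le_def A B).1 h).2 x

theorem reApplyInnerSelf_nonneg {A : H →L[ℂ] H} (h : 0 ≤ A) (x : H) :
    0 ≤ A.reApplyInnerSelf x := by
  simpa [reApplyInnerSelf_apply] using reApplyInnerSelf_mono h x

variable [CompleteSpace H]

theorem reApplyInnerSelf_star_mul_self (T : H →L[ℂ] H) (x : H) :
    (star T * T).reApplyInnerSelf x = ‖T x‖ ^ 2 := by
  simp [reApplyInnerSelf_apply, star_eq_adjoint, adjoint_inner_left, ← Complex.ofReal_pow]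

theorem reApplyInnerSelf_conj (C A : H →L[ℂ] H) (x : H) :
    (C * A * star C).reApplyInnerSelf x = A.reApplyInnerSelf (star C x) := by
  simp [reApplyInnerSelf_apply, star_eq_adjoint, adjoint_inner_right]

theorem le_of_reApplyInnerSelf_le {A B : H →L[ℂ] H} (hA : IsSelfAdjoint A) (hB : IsSelfAdjoint B)
    (h : ∀ x, A.reApplyInnerSelf x ≤ B.reApplyInnerSelf x) : A ≤ B := by
  rw [ContinuousLinearMap.le_def]
  refine isPositive_def'.2 ⟨hB.sub hA, fun x => ?_⟩
  simpa [reApplyInnerSelf_apply, inner_sub_left] using h x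

theorem ker_star_mul_self (T : H →L[ℂ] H) : (star T * T).ker = T.ker :=
  ker_adjoint_comp_self T

theorem ker_le_of_le {D G : H →L[ℂ] H} (hD : 0 ≤ D) (h : D ≤ G) : G.ker ≤ D.ker := by
  intro x hx
  have hD_sqrt : star (CFC.sqrt D) * CFC.sqrt D = D := by
    rw [(CFC.sqrt_nonneg D).isSelfAdjoint.star_eq, CFC.sqrt_mul_sqrt_self D]
  have hform : D.reApplyInnerSelf x ≤ 0 := by
    simpa [reApplyInnerSelf_apply, show G x = 0 from hx] using reApplyInnerSelf_mono h x
  rw [← hD_sqrt, reApplyInnerSelf_star_mul_self] at hform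
  rw [← hD_sqrt, ker_star_mul_self]
  simpa using hform.antisymm (sq_nonneg _)

end QuadraticForm

section PolarDecomposition

variable {H : Type*} [NormedAddCommGroup H] [InnerProductSpace ℂ H] [CompleteSpace H]

/-- **Douglas factorization.** -/
theorem exists_contraction_mul_eq {S R : H →L[ℂ] H} (h : ∀ x, ‖S x‖ ≤ ‖R x‖) :
    ∃ C : H →L[ℂ] H, C * R = S ∧ ‖C‖ ≤ 1 ∧ (star R).ker ≤ C.ker := by
  let K : Submodule ℂ H := R.range.topologicalClosure
  have : CompleteSpace K := (Submodule.isClosed_topologicalClosure _).completeSpace_coe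
  let e : H →ₗ[ℂ] K :=
    R.toLinearMap.codRestrict K fun x => Submodule.le_topologicalClosure _ ⟨x, rfl⟩
  have he : DenseRange e := fun y => by
    rw [closure_subtype, ← Set.range_comp]
    exact y.2
  have hSe : ∀ x, ‖S.toLinearMap x‖ ≤ 1 * ‖e x‖ := fun x => by
    rw [one_mul]
    exact h x
  refine ⟨S.toLinearMap.extendOfNorm e ∘L K.orthogonalProjectionOnto, ?_, ?_, fun x hx => ?_⟩
  · ext x
    have hx : K.orthogonalProjectionOnto (R x) = e x :=
      Submodule.orthogonalProjectionOnto_mem_subspace_eq_self (e x)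
    change S.toLinearMap.extendOfNorm e (K.orthogonalProjectionOnto (R x)) = S x
    rw [hx]
    exact LinearMap.extendOfNorm_eq he ⟨1, hSe⟩ x
  · exact (opNorm_comp_le _ _).trans <| mul_le_one₀
      (LinearMap.opNorm_extendOfNorm_le he zero_le_one hSe) (norm_nonneg _)
      K.orthogonalProjectionOnto_norm_le
  · have hxK : x ∈ Kᗮ := by
      rwa [Submodule.orthogonal_closure, orthogonal_range]
    change S.toLinearMap.extendOfNorm e (K.orthogonalProjectionOnto x) = 0
    rw [Submodule.orthogonalProjectionOnto_eq_zero_iff.2 hxK, map_zero]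

namespace IsPartialIsometryOp

variable {N M G : H →L[ℂ] H}

protected theorem star (hN : IsPartialIsometryOp N) : IsPartialIsometryOp (star N) := by
  simpa [IsPartialIsometryOp, mul_assoc] using congrArg star hN

theorem mul_star_mul_of_ker_le (hN : IsPartialIsometryOp N) (h : N.ker ≤ G.ker) :
    G * (star N * N) = G := by
  have h0 : N * (1 - star N * N) = 0 := by rw [mul_sub, mul_one, ← mul_assoc, hN, sub_self]
  have h1 := mul_eq_zero_of_ker_le h h0
  rwa [mul_sub, mul_one, sub_eq_zero, eq_comm] at h1

theorem star_mul_self_eq_of_ker_eq (hN : IsPartialIsometryOp N) (hM : IsPartialIsometryOp M)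
    (h : N.ker = M.ker) : star N * N = star M * M := by
  have h1 : star N * N * (star M * M) = star N * N := by
    rw [mul_assoc, hM.mul_star_mul_of_ker_le h.ge]
  have h2 : star M * M * (star N * N) = star M * M := by
    rw [mul_assoc, hN.mul_star_mul_of_ker_le h.le]
  have h3 : star (star N * N * (star M * M)) =
      star M * M * (star N * N) := by simp [mul_assoc]
  rwa [h1, h2, star_mul, star_star] at h3

end IsPartialIsometryOp

theorem IsIsometryOp.isPartialIsometryOp {U : H →L[ℂ] H} (hU : IsIsometryOp U) :
    IsPartialIsometryOp U := by
  rw [IsPartialIsometryOp, mul_assoc, hU, mul_one]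

/-- `N` is the partially isometric factor in the polar decomposition `T = N |T|`. -/
structure IsPolarFactor (N T : H →L[ℂ] H) : Prop where
  isPartialIsometryOp : IsPartialIsometryOp N
  mul_abs : N * CFC.abs T = T
  ker_eq : N.ker = T.ker

theorem star_abs (T : H →L[ℂ] H) : star (CFC.abs T) = CFC.abs T :=
  (CFC.abs_nonneg T).isSelfAdjoint.star_eq

theorem ker_abs (T : H →L[ℂ] H) : (CFC.abs T).ker = T.ker := by
  rw [← ker_star_mul_self, star_abs, CFC.abs_mul_abs, ker_star_mul_self]

theorem exists_isPolarFactor (T : H →L[ℂ] H) : ∃ N, IsPolarFactor N T := by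
  have hnorm : ∀ x, ‖T x‖ ≤ ‖CFC.abs T x‖ := fun x => by
    rw [← sq_le_sq₀ (norm_nonneg _) (norm_nonneg _), ← reApplyInnerSelf_star_mul_self,
      ← reApplyInnerSelf_star_mul_self, star_abs, CFC.abs_mul_abs]
  obtain ⟨N, hNT, -, hker⟩ := exists_contraction_mul_eq hnorm
  rw [star_abs] at hker
  have hTN : CFC.abs T * star N = star T := by
    simpa [star_abs] using congrArg star hNT
  -- `Z = (1 - N*N)|T|` is annihilated by `|T|`, hence by `N`, so `Z*Z = |T|(1 - N*N)Z = 0`.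
  have hZ : (1 - star N * N) * CFC.abs T = 0 := by
    set Z := (1 - star N * N) * CFC.abs T with hZdef
    have hTZ : CFC.abs T * Z = 0 := by
      rw [hZdef, sub_mul, one_mul, mul_sub, CFC.abs_mul_abs, mul_assoc, hNT, ← mul_assoc, hTN,
        sub_self]
    have hNZ : N * Z = 0 := mul_eq_zero_of_ker_le hker hTZ
    rw [← CStarRing.star_mul_self_eq_zero_iff]
    have hstar : star Z = CFC.abs T - star T * N := by
      simp [hZdef, star_abs, mul_sub, ← mul_assoc, hTN]
    rw [hstar, sub_mul, hTZ, mul_assoc, hNZ, mul_zero, sub_zero]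
  have habs : CFC.abs T * (1 - star N * N) = 0 := by
    simpa [star_abs] using congrArg star hZ
  refine ⟨N, ?_, hNT, le_antisymm (fun x hx => ?_) (ker_abs T ▸ hker)⟩
  · have h := mul_eq_zero_of_ker_le hker habs
    rwa [mul_sub, mul_one, sub_eq_zero, eq_comm, ← mul_assoc] at h
  · rw [mul_sub, mul_one, sub_eq_zero] at habs
    rw [← ker_abs, habs]
    simp [show N x = 0 from hx]

namespace IsPolarFactor

variable {N T : H →L[ℂ] H}

theorem abs_mul_star (h : IsPolarFactor N T) : CFC.abs T * star N = star T := by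
  simpa [star_abs] using congrArg star h.mul_abs

theorem ker_star_eq (h : IsPolarFactor N T) : (star N).ker = (star T).ker := by
  refine le_antisymm (fun y hy => ?_) fun y hy => ?_
  · rw [← h.abs_mul_star]
    simp [show star N y = 0 from hy]
  · have hy' : CFC.abs T (star N y) = 0 := by
      rw [← mul_apply_eq_comp, h.abs_mul_star]
      exact hy
    have hNy : N (star N y) = 0 := (h.ker_eq.trans (ker_abs T).symm).ge hy'
    rw [← h.isPartialIsometryOp.star, star_star, mul_assoc]
    simp [hNy]

theorem conj_star_mul_self (h : IsPolarFactor N T) : N * (star T * T) * star N = T * star T := by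
  rw [← CFC.abs_mul_abs, ← mul_assoc, h.mul_abs, mul_assoc, h.abs_mul_star]

end IsPolarFactor

/-- The isometric part of `J` on `ker N`, completed by `N` on `(ker N)ᗮ`. -/
theorem exists_isometry_extending {N J : H →L[ℂ] H} (hN : IsPartialIsometryOp N)
    (hinj : ∀ x, N x = 0 → J x = 0 → x = 0) (hJ : ∀ x, N x = 0 → star N (J x) = 0) :
    ∃ U, IsIsometryOp U ∧ U * (star N * N) = N := by
  set P : H →L[ℂ] H := 1 - star N * N with hP
  have hNP : N * P = 0 := by rw [hP, mul_sub, mul_one, ← mul_assoc, hN, sub_self]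
  have hNPx : ∀ x, N (P x) = 0 := fun x => congr($hNP x)
  have hPstar : star P = P := by simp [hP]
  have hPP : P * P = P := by
    nth_rw 1 [hP]
    rw [sub_mul, one_mul, mul_assoc, hNP, mul_zero, sub_zero]
  have hP_isom : IsPartialIsometryOp P := by rw [IsPartialIsometryOp, hPstar, hPP, hPP]
  obtain ⟨K, hK⟩ := exists_isPolarFactor (J * P)
  have hKP : star K * K = P := by
    have hker : K.ker = P.ker := by
      rw [hK.ker_eq]
      refine le_antisymm (fun x hx => hinj _ (hNPx x) hx) fun x hx => ?_
      simp [show P x = 0 from hx]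
    rw [hK.isPartialIsometryOp.star_mul_self_eq_of_ker_eq hP_isom hker, hPstar, hPP]
  have hKN : star K * N = 0 := by
    refine mul_eq_zero_of_ker_le hK.ker_star_eq.ge ?_
    have hNJP : star N * (J * P) = 0 := by
      ext x
      exact hJ _ (hNPx x)
    simpa using congrArg star hNJP
  have hNK : star N * K = 0 := by simpa using congrArg star hKN
  have hKNN : K * (star N * N) = 0 := by
    have h := hK.isPartialIsometryOp
    rw [IsPartialIsometryOp, mul_assoc, hKP, hP, mul_sub, mul_one, sub_eq_self] at h
    exact h
  refine ⟨N + K, ?_, ?_⟩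
  · rw [IsIsometryOp, star_add, add_mul, mul_add, mul_add, hNK, hKN, hKP, hP]
    abel
  · rw [add_mul, hKNN, ← mul_assoc, hN, add_zero]

theorem conj_eq_of_mul_star_mul_self_eq {N U D : H →L[ℂ] H} (hN : IsPartialIsometryOp N)
    (hU : U * (star N * N) = N) (hD : IsSelfAdjoint D) (hker : N.ker ≤ D.ker) :
    U * D * star U = N * D * star N := by
  have hDN : D * (star N * N) = D := hN.mul_star_mul_of_ker_le hker
  have hND : star N * N * D = D := by simpa [hD.star_eq, mul_assoc] using congrArg star hDN
  calc U * D * star U = U * (star N * N * D * (star N * N)) * star U := by rw [hND, hDN]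
    _ = (U * (star N * N)) * D * star (U * (star N * N)) := by simp [mul_assoc]
    _ = N * D * star N := by rw [hU]

theorem exists_isometry_extending_of_finiteDimensional [FiniteDimensional ℂ H] {N : H →L[ℂ] H}
    (hN : IsPartialIsometryOp N) : ∃ U, IsIsometryOp U ∧ U * (star N * N) = N := by
  have hfin : Module.finrank ℂ N.ker = Module.finrank ℂ (star N).ker := by
    have h₁ := N.toLinearMap.finrank_range_add_finrank_ker
    have h₂ := (star N).toLinearMap.finrank_range_add_finrank_ker
    have h₃ : Module.finrank ℂ (star N).range = Module.finrank ℂ N.range :=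
      LinearMap.finrank_range_adjoint N.toLinearMap
    lia
  let e := LinearEquiv.ofFinrankEq N.ker (star N).ker hfin
  let J : H →ₗ[ℂ] H :=
    (star N).ker.subtype ∘ₗ e.toLinearMap ∘ₗ N.ker.orthogonalProjectionOnto.toLinearMap
  have hJ : ∀ x (hx : N x = 0), J x = e ⟨x, hx⟩ := fun x hx =>
    congrArg (fun z => (e z : H))
      (Submodule.orthogonalProjectionOnto_mem_subspace_eq_self (⟨x, hx⟩ : N.ker))
  refine exists_isometry_extending (J := J.toContinuousLinearMap) hN (fun x hx hJx => ?_)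
    fun x hx => ?_
  · have he : e ⟨x, hx⟩ = 0 := Subtype.ext ((hJ x hx).symm.trans hJx)
    exact congrArg Subtype.val (e.map_eq_zero_iff.1 he)
  · change star N (J x) = 0
    rw [hJ x hx]
    exact (e ⟨x, hx⟩).2

end PolarDecomposition

section RealPowers

section CStarAlgebra

variable {A : Type*} [CStarAlgebra A] [PartialOrder A] [StarOrderedRing A]

theorem star_mul_self_le_one {c : A} (hc : ‖c‖ ≤ 1) : star c * c ≤ 1 := by
  rw [← CStarAlgebra.norm_le_one_iff_of_nonneg _ (star_mul_self_nonneg c),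
    CStarRing.norm_star_mul_self]
  exact mul_le_one₀ hc (norm_nonneg c) hc

theorem star_rpow (a : A) (r : ℝ) : star (a ^ r) = a ^ r :=
  CFC.rpow_nonneg.isSelfAdjoint.star_eq

theorem rpow_mul_rpow_of_nonneg (a : A) {r s : ℝ} (hr : 0 ≤ r) (hs : 0 ≤ s) :
    a ^ r * a ^ s = a ^ (r + s) := by
  simp only [CFC.rpow_def]
  rw [← cfc_mul (fun x : NNReal => x ^ r) (fun x => x ^ s) a
    (NNReal.continuous_rpow_const hr).continuousOn (NNReal.continuous_rpow_const hs).continuousOn]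
  exact cfc_congr fun x _ => (NNReal.rpow_add_of_nonneg x hr hs).symm

theorem rpow_half_mul_rpow_half (a : A) {r : ℝ} (hr : 0 ≤ r) :
    a ^ (r / 2) * a ^ (r / 2) = a ^ r := by
  rw [rpow_mul_rpow_of_nonneg a (by positivity) (by positivity), add_halves]

theorem sqrt_mul_sqrt {a : A} (ha : 0 ≤ a) : a ^ (1 / 2 : ℝ) * a ^ (1 / 2 : ℝ) = a := by
  rw [rpow_half_mul_rpow_half a zero_le_one, CFC.rpow_one a]

theorem real_smul_rpow {a : A} (ha : 0 ≤ a) {c r : ℝ} (hc : 0 ≤ c) (hr : 0 ≤ r) :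
    (c • a) ^ r = (c ^ r) • a ^ r := by
  have hcont : ∀ s : Set ℝ, ContinuousOn (fun x : ℝ => x ^ r) s := fun _ =>
    (Real.continuous_rpow_const hr).continuousOn
  rw [CFC.rpow_eq_cfc_real (smul_nonneg hc ha), CFC.rpow_eq_cfc_real ha,
    ← cfc_smul _ _ _ (hcont _), ← cfc_comp_smul _ _ _ (hcont _)]
  refine cfc_congr fun x hx => ?_
  simp [Real.mul_rpow hc (spectrum_nonneg_of_nonneg ha hx)]

/-- Jensen's inequality for the operator concave function `x ↦ x ^ r`. -/
theorem card_rpow_smul_sum_rpow_le {ι : Type*} [Fintype ι] {b : ι → A} (hb : ∀ j, 0 ≤ b j)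
    {r : ℝ} (hr0 : 0 ≤ r) (hr1 : r ≤ 1) :
    ((Fintype.card ι : ℝ) ^ (r - 1)) • ∑ j, b j ^ r ≤ (∑ j, b j) ^ r := by
  cases isEmpty_or_nonempty ι
  · simp
  have hn : (0 : ℝ) < Fintype.card ι := by exact_mod_cast Fintype.card_pos
  have h := (CFC.concaveOn_rpow (A := A) ⟨hr0, hr1⟩).le_map_sum
    (t := Finset.univ) (w := fun _ : ι => (Fintype.card ι : ℝ)⁻¹)
    (p := fun j => (Fintype.card ι : ℝ) • b j) (fun _ _ => by positivity) (by simp [hn.ne'])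
    (fun j _ => smul_nonneg hn.le (hb j))
  simp only [real_smul_rpow (hb _) hn.le hr0, smul_smul, inv_mul_cancel₀ hn.ne', one_smul,
    ← Finset.smul_sum] at h
  rwa [Real.rpow_sub_one hn.ne', div_eq_inv_mul]

end CStarAlgebra

variable {H : Type*} [NormedAddCommGroup H] [InnerProductSpace ℂ H] [CompleteSpace H]

theorem cfc_apply_eigenvector {B : H →L[ℂ] H} (hB : IsSelfAdjoint B) {x : H} {β : ℝ}
    (hx0 : x ≠ 0) (hx : B x = (β : ℂ) • x) {f : ℝ → ℝ} (hf : ContinuousOn f (spectrum ℝ B)) :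
    cfc f B x = (f β : ℂ) • x := by
  have hβ : β ∈ spectrum ℝ B := by
    intro hunit
    obtain ⟨v, hv⟩ := hunit.exists_left_inv
    have hker : (algebraMap ℝ (H →L[ℂ] H) β - B) x = 0 := by
      rw [sub_apply, hx, Algebra.algebraMap_eq_smul_one, smul_apply, one_apply_eq_self, sub_eq_zero]
      rfl
    refine hx0 ?_
    rw [← one_apply_eq_self (F := H →L[ℂ] H) x, ← hv, mul_apply_eq_comp, hker, map_zero]
  rw [cfc_apply f B hB hf]
  suffices h : ∀ g : C(spectrum ℝ B, ℝ), cfcHom hB g x = (g ⟨β, hβ⟩ : ℂ) • x from h _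
  intro g
  induction g using ContinuousMap.induction_on_of_compact with
  | const r =>
    have hconst : cfcHom hB (ContinuousMap.const _ r) = algebraMap ℝ (H →L[ℂ] H) r :=
      AlgHomClass.commutes (cfcHom hB) r
    rw [hconst, Algebra.algebraMap_eq_smul_one]
    rfl
  | id => rw [cfcHom_id hB]; simpa using hx
  | star_id => rw [map_star, cfcHom_id, hB.star_eq]; simpa using hx
  | add f g hf hg => rw [map_add, add_apply, hf, hg, ← add_smul]; simp
  | mul f g hf hg => rw [map_mul, mul_apply_eq_comp, hg, map_smul, hf, smul_smul]; simp [mul_comm]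
  | frequently f hf =>
    have hclosed : IsClosed {g : C(spectrum ℝ B, ℝ) | cfcHom hB g x = (g ⟨β, hβ⟩ : ℂ) • x} := by
      refine isClosed_eq ?_ (by fun_prop)
      exact (ContinuousLinearMap.apply ℂ H x).continuous.comp (cfcHom_continuous hB)
    exact hclosed.closure_subset (mem_closure_of_frequently_of_tendsto hf Filter.tendsto_id)

theorem rpow_apply_eigenvector {B : H →L[ℂ] H} (hB : 0 ≤ B) {x : H} {β : ℝ}
    (hx : B x = (β : ℂ) • x) {r : ℝ} (hr : 0 ≤ r) :
    (B ^ r) x = ((β ^ r : ℝ) : ℂ) • x := by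
  by_cases hx0 : x = 0
  · simp [hx0]
  rw [CFC.rpow_eq_cfc_real hB]
  exact cfc_apply_eigenvector hB.isSelfAdjoint hx0 hx (Real.continuous_rpow_const hr).continuousOn

theorem ker_rpow {B : H →L[ℂ] H} (hB : 0 ≤ B) {r : ℝ} (hr : 0 < r) : (B ^ r).ker = B.ker := by
  have ker_le : ∀ {D : H →L[ℂ] H} {s : ℝ}, 0 ≤ D → 0 < s → D.ker ≤ (D ^ s).ker :=
    fun {D s} hD hs x hx => by
      simpa [Real.zero_rpow hs.ne'] using
        rpow_apply_eigenvector hD (β := 0) (by simpa using hx) hs.le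
  refine le_antisymm ?_ (ker_le hB hr)
  have h := ker_le (D := B ^ r) CFC.rpow_nonneg (inv_pos.2 hr)
  rwa [CFC.rpow_rpow_of_exponent_nonneg B r r⁻¹ hr.le (inv_pos.2 hr).le, mul_inv_cancel₀ hr.ne',
    CFC.rpow_one B] at h

theorem ker_rpow_eq_ker_rpow {B : H →L[ℂ] H} (hB : 0 ≤ B) {a b : ℝ} (ha : 0 < a) (hb : 0 < b) :
    (B ^ a).ker = (B ^ b).ker :=
  (ker_rpow hB ha).trans (ker_rpow hB hb).symm

theorem rpow_mul_mul_rpow_eq_zero {S E : H →L[ℂ] H} (hS : 0 ≤ S) {a b : ℝ} (ha : 0 < a)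
    (hb : 0 < b) (h : S ^ a * E * S ^ a = 0) : S ^ b * E * S ^ b = 0 := by
  have hker := (ker_rpow_eq_ker_rpow hS ha hb).le
  have hleft : S ^ b * (E * S ^ a) = 0 := mul_eq_zero_of_ker_le hker (by rw [← mul_assoc, h])
  have hstar : S ^ a * (star E * S ^ b) = 0 := by
    simpa [star_rpow, mul_assoc] using congrArg star hleft
  simpa [star_rpow, mul_assoc] using congrArg star (mul_eq_zero_of_ker_le hker hstar)

theorem norm_rpow_half_apply_sq (B : H →L[ℂ] H) {r : ℝ} (hr : 0 ≤ r) (x : H) :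
    ‖(B ^ (r / 2)) x‖ ^ 2 = (B ^ r).reApplyInnerSelf x := by
  rw [← reApplyInnerSelf_star_mul_self, star_rpow, rpow_half_mul_rpow_half B hr]

theorem isCompactOperator_rpow {B : H →L[ℂ] H} (hB : 0 ≤ B) (hBc : IsCompactOperator B) {r : ℝ}
    (hr : 1 ≤ r) : IsCompactOperator (B ^ r) := by
  have h : B ^ (r - 1) * B = B ^ r := by
    nth_rw 2 [← CFC.rpow_one B]
    rw [rpow_mul_rpow_of_nonneg B (by linarith) zero_le_one, sub_add_cancel]
  rw [← h]
  exact hBc.clm_comp (B ^ (r - 1))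

theorem rpow_add_mul_sub_le_rpow {c x r : ℝ} (hc : 0 < c) (hx : 0 ≤ x) (hr : 1 ≤ r) :
    r * c ^ (r - 1) * x + c ^ r * (1 - r) ≤ x ^ r := by
  have hbernoulli := one_add_mul_self_le_rpow_one_add (s := x / c - 1)
    (by linarith [div_nonneg hx hc.le]) hr
  rw [add_sub_cancel, Real.div_rpow hx hc.le, le_div_iff₀ (by positivity)] at hbernoulli
  rw [Real.rpow_sub_one hc.ne']
  calc r * (c ^ r / c) * x + c ^ r * (1 - r) = (1 + r * (x / c - 1)) * c ^ r := by
        field_simp; ring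
    _ ≤ x ^ r := hbernoulli

theorem smul_add_algebraMap_le_rpow {B : H →L[ℂ] H} (hB : 0 ≤ B) {c r : ℝ} (hc : 0 < c)
    (hr : 1 ≤ r) : (r * c ^ (r - 1)) • B + algebraMap ℝ _ (c ^ r * (1 - r)) ≤ B ^ r := by
  have hcfc : (r * c ^ (r - 1)) • B + algebraMap ℝ _ (c ^ r * (1 - r)) =
      cfc (fun x : ℝ => (r * c ^ (r - 1)) • x + c ^ r * (1 - r)) B := by
    rw [cfc_add_const _ (fun x : ℝ => (r * c ^ (r - 1)) • x) B, cfc_smul _ (fun x => x) B,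
      cfc_id' ℝ B]
  rw [hcfc, CFC.rpow_eq_cfc_real hB]
  exact cfc_mono (fun x hx => rpow_add_mul_sub_le_rpow hc (spectrum_nonneg_of_nonneg hB hx) hr)
    (by fun_prop) (Real.continuous_rpow_const (by linarith)).continuousOn

theorem rpow_reApplyInnerSelf_le {B : H →L[ℂ] H} (hB : 0 ≤ B) {r : ℝ} (hr : 1 ≤ r) {y : H}
    (hy : ‖y‖ ≤ 1) : B.reApplyInnerSelf y ^ r ≤ (B ^ r).reApplyInnerSelf y := by
  have hr0 : 0 < r := by linarith
  rcases (reApplyInnerSelf_nonneg hB y).eq_or_lt with h0 | hc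
  · rw [← h0, Real.zero_rpow hr0.ne']
    exact reApplyInnerSelf_nonneg CFC.rpow_nonneg y
  set c := B.reApplyInnerSelf y with hcdef
  have htangent := reApplyInnerSelf_mono (smul_add_algebraMap_le_rpow hB hc hr) y
  rw [reApplyInnerSelf_add, reApplyInnerSelf_real_smul, Algebra.algebraMap_eq_smul_one,
    reApplyInnerSelf_real_smul, reApplyInnerSelf_one, ← hcdef, mul_assoc,
    ← Real.rpow_add_one hc.ne', sub_add_cancel] at htangent
  have hdefect : 0 ≤ c ^ r * (r - 1) * (1 - ‖y‖ ^ 2) :=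
    mul_nonneg (mul_nonneg (by positivity) (by linarith))
      (sub_nonneg.2 (pow_le_one₀ (norm_nonneg _) hy))
  linarith

end RealPowers

section SqrtFactor

variable {H : Type*} [NormedAddCommGroup H] [InnerProductSpace ℂ H] [CompleteSpace H]
  {C D K S : H →L[ℂ] H}

theorem mul_rpow_half_mul_star (C S : H →L[ℂ] H) {r : ℝ} (hr : 0 ≤ r) :
    C * S ^ (r / 2) * star (C * S ^ (r / 2)) = C * S ^ r * star C := by
  rw [← rpow_half_mul_rpow_half S hr, star_mul, star_rpow]
  simp only [mul_assoc]

/-- `C` is the contraction, vanishing on the kernel of `S`, through which the square root of `D`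
factors over the square root of `S`; it exists when `0 ≤ D ≤ S`. -/
structure IsSqrtFactor (C D S : H →L[ℂ] H) : Prop where
  mul_sqrt : C * S ^ (1 / 2 : ℝ) = D ^ (1 / 2 : ℝ)
  norm_le_one : ‖C‖ ≤ 1
  ker_le : S.ker ≤ C.ker

theorem exists_isSqrtFactor (hD : 0 ≤ D) (hDS : D ≤ S) : ∃ C, IsSqrtFactor C D S := by
  have hS : 0 ≤ S := hD.trans hDS
  have hnorm : ∀ x, ‖(D ^ (1 / 2 : ℝ)) x‖ ≤ ‖(S ^ (1 / 2 : ℝ)) x‖ := fun x => by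
    rw [← sq_le_sq₀ (norm_nonneg _) (norm_nonneg _), norm_rpow_half_apply_sq D zero_le_one,
      norm_rpow_half_apply_sq S zero_le_one, CFC.rpow_one D, CFC.rpow_one S]
    exact reApplyInnerSelf_mono hDS x
  obtain ⟨C, hC, hC1, hker⟩ := exists_contraction_mul_eq hnorm
  refine ⟨C, hC, hC1, ?_⟩
  rwa [star_rpow, ker_rpow hS (by norm_num)] at hker

namespace IsSqrtFactor

theorem sqrt_mul_star (h : IsSqrtFactor C D S) : S ^ (1 / 2 : ℝ) * star C = D ^ (1 / 2 : ℝ) := by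
  simpa [star_rpow] using congrArg star h.mul_sqrt

theorem conj_eq (h : IsSqrtFactor C D S) (hD : 0 ≤ D) (hS : 0 ≤ S) : C * S * star C = D := by
  rw [← sqrt_mul_sqrt hS, ← mul_assoc, h.mul_sqrt, mul_assoc, h.sqrt_mul_star, sqrt_mul_sqrt hD]

theorem rpow_half_mul_star (h : IsSqrtFactor C D S) (hD : 0 ≤ D) (hS : 0 ≤ S) {r : ℝ} (hr0 : 0 < r)
    (hr1 : r < 1) (hK : IsSqrtFactor K (D ^ (1 - r)) (S ^ (1 - r))) :
    S ^ (r / 2) * star C = star K * D ^ (r / 2) := by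
  have hq : 0 < 1 - r := by linarith
  have hSK : S ^ ((1 - r) / 2) * star K = D ^ ((1 - r) / 2) := by
    have hSK := hK.sqrt_mul_star
    rwa [CFC.rpow_rpow_of_exponent_nonneg S _ _ hq.le (by norm_num),
      CFC.rpow_rpow_of_exponent_nonneg D _ _ hq.le (by norm_num), mul_one_div] at hSK
  have hhalf : ∀ B : H →L[ℂ] H, B ^ ((1 - r) / 2) * B ^ (r / 2) = B ^ (1 / 2 : ℝ) := fun B => by
    rw [rpow_mul_rpow_of_nonneg B (by positivity) (by positivity)]
    ring_nf
  set Z := S ^ (r / 2) * star C - star K * D ^ (r / 2) with hZ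
  have hSZ : S ^ ((1 - r) / 2) * Z = 0 := by
    rw [hZ, mul_sub, ← mul_assoc, ← mul_assoc, hhalf, hSK, hhalf, h.sqrt_mul_star, sub_self]
  have hrZ : S ^ (r / 2) * Z = 0 :=
    mul_eq_zero_of_ker_le (ker_rpow_eq_ker_rpow hS (by positivity) (by positivity)).le hSZ
  have hKZ : K * Z = 0 :=
    mul_eq_zero_of_ker_le
      ((ker_rpow_eq_ker_rpow hS (by positivity) hq).le.trans hK.ker_le) hSZ
  rw [← sub_eq_zero, ← hZ, ← CStarRing.star_mul_self_eq_zero_iff]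
  nth_rw 1 [hZ]
  rw [star_sub, star_mul, star_mul, star_star, star_star, star_rpow, star_rpow, sub_mul,
    mul_assoc, mul_assoc, hrZ, hKZ, mul_zero, mul_zero, sub_zero]

/-- **Hansen's inequality** for the function `x ↦ x ^ r`. -/
theorem conj_rpow_le (h : IsSqrtFactor C D S) (hD : 0 ≤ D) (hDS : D ≤ S) {r : ℝ} (hr0 : 0 < r)
    (hr1 : r ≤ 1) : C * S ^ r * star C ≤ D ^ r := by
  have hS : 0 ≤ S := hD.trans hDS
  rcases hr1.eq_or_lt with rfl | hr1
  · rw [CFC.rpow_one S, CFC.rpow_one D, h.conj_eq hD hS]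
  obtain ⟨K, hK⟩ := exists_isSqrtFactor (D := D ^ (1 - r)) CFC.rpow_nonneg
    (CFC.rpow_le_rpow ⟨by linarith, by linarith⟩ hDS)
  calc C * S ^ r * star C = star (S ^ (r / 2) * star C) * (S ^ (r / 2) * star C) := by
        rw [← mul_rpow_half_mul_star C S hr0.le]
        simp [star_rpow]
    _ = star (D ^ (r / 2)) * (K * star K) * D ^ (r / 2) := by
        rw [h.rpow_half_mul_star hD hS hr0 hr1 hK]
        simp [mul_assoc]
    _ ≤ star (D ^ (r / 2)) * 1 * D ^ (r / 2) := by
        refine star_left_conjugate_le_conjugate ?_ _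
        simpa using star_mul_self_le_one (c := star K) (by simpa using hK.norm_le_one)
    _ = D ^ r := by rw [mul_one, star_rpow, rpow_half_mul_rpow_half D hr0.le]

theorem isCompactOperator (h : IsSqrtFactor C D S) (hD : 0 ≤ D) (hS : 0 ≤ S)
    (hSc : IsCompactOperator S) : IsCompactOperator D := by
  rw [← h.conj_eq hD hS]
  exact (hSc.clm_comp C).comp_clm (star C)

end IsSqrtFactor

theorem isCompactOperator_of_le (hD : 0 ≤ D) (hDS : D ≤ S) (hSc : IsCompactOperator S) :
    IsCompactOperator D := by
  obtain ⟨C, hC⟩ := exists_isSqrtFactor hD hDS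
  exact hC.isCompactOperator hD (hD.trans hDS) hSc

theorem sum_star_mul_self_rpow {ι : Type*} [Fintype ι] {C A : ι → H →L[ℂ] H} (hS : 0 ≤ S)
    (hA : ∀ i, 0 ≤ A i) (hsum : ∑ i, A i = S) (hC : ∀ i, IsSqrtFactor (C i) (A i) S) {r : ℝ}
    (hr : 0 < r) : ∑ i, star (C i * S ^ (r / 2)) * (C i * S ^ (r / 2)) = S ^ r := by
  have hconj : ∀ a : ℝ, 0 < a → S ^ (a / 2) * (∑ i, star (C i) * C i - 1) * S ^ (a / 2) =
      ∑ i, star (C i * S ^ (a / 2)) * (C i * S ^ (a / 2)) - S ^ a := fun a ha => by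
    rw [mul_sub, sub_mul, mul_one, rpow_half_mul_rpow_half S ha.le, Finset.mul_sum, Finset.sum_mul]
    simp only [star_mul, star_rpow, mul_assoc]
  have h1 : S ^ (1 / 2 : ℝ) * (∑ i, star (C i) * C i - 1) * S ^ (1 / 2 : ℝ) = 0 := by
    rw [hconj 1 one_pos, sub_eq_zero, CFC.rpow_one S, ← hsum]
    refine Finset.sum_congr rfl fun i _ => ?_
    rw [hsum, (hC i).mul_sqrt, star_rpow, sqrt_mul_sqrt (hA i)]
  rw [← sub_eq_zero, ← hconj r hr]
  exact rpow_mul_mul_rpow_eq_zero hS (by norm_num) (by positivity) h1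

end SqrtFactor

section Subadditivity

variable {H : Type*} [NormedAddCommGroup H] [InnerProductSpace ℂ H] [CompleteSpace H]

theorem injective_rpow_add_starProjection {S : H →L[ℂ] H} (hS : 0 ≤ S) {a : ℝ} (ha : 0 ≤ a)
    [S.ker.HasOrthogonalProjection] {x : H} (hx : (S ^ a + S.ker.starProjection) x = 0) :
    x = 0 := by
  have hP : 0 ≤ S.ker.starProjection := isStarProjection_starProjection.nonneg
  have hSx : (S ^ a) x = 0 := ker_le_of_le CFC.rpow_nonneg (le_add_of_nonneg_right hP) hx
  have hPx : S.ker.starProjection x = 0 :=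
    ker_le_of_le hP (le_add_of_nonneg_left CFC.rpow_nonneg) hx
  rcases ha.eq_or_lt with rfl | ha
  · simpa [CFC.rpow_zero S] using hSx
  · rw [← hPx, Submodule.starProjection_eq_self_iff.2]
    exact (ker_rpow hS ha).le hSx

theorem IsSqrtFactor.exists_isometry_le {C D S : H →L[ℂ] H} (h : IsSqrtFactor C D S)
    (hD : 0 ≤ D) (hDS : D ≤ S) {r : ℝ} (hr0 : 0 < r) (hr1 : r ≤ 1) :
    ∃ U, IsIsometryOp U ∧
      star (C * S ^ (r / 2)) * (C * S ^ (r / 2)) ≤ U * D ^ r * star U := by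
  have hS : 0 ≤ S := hD.trans hDS
  have : CompleteSpace S.ker := S.isClosed_ker.completeSpace_coe
  set R := C * S ^ (r / 2) with hR
  obtain ⟨N, hN⟩ := exists_isPolarFactor (star R)
  set J := S ^ ((1 - r) / 2) + S.ker.starProjection with hJ
  have hRJ : R * J = D ^ (1 / 2 : ℝ) := by
    have hSP : S ^ (r / 2) * S.ker.starProjection = 0 :=
      mul_eq_zero_of_ker_le (ker_rpow hS (by positivity)).ge <| by
        ext x
        exact S.ker.starProjection_apply_mem x
    rw [hR, hJ, mul_add, mul_assoc, mul_assoc, hSP, mul_zero, add_zero,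
      rpow_mul_rpow_of_nonneg S (by positivity) (by linarith), ← add_div, add_sub_cancel,
      h.mul_sqrt]
  have hDx : ∀ x, N x = 0 → (D ^ (1 / 2 : ℝ)) x = 0 := fun x hx => by
    have hRx : star R x = 0 := hN.ker_eq.le hx
    rw [hR, star_mul, star_rpow] at hRx
    rw [← h.sqrt_mul_star]
    exact (ker_rpow_eq_ker_rpow hS (by positivity) (by norm_num)).le hRx
  obtain ⟨U, hU, hUN⟩ := exists_isometry_extending (J := J) hN.isPartialIsometryOp
    (fun x _ => injective_rpow_add_starProjection hS (by linarith))
    fun x hx => by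
      refine hN.ker_star_eq.ge ?_
      rw [star_star]
      exact (congr($hRJ x)).trans (hDx x hx)
  refine ⟨U, hU, ?_⟩
  calc star R * R = U * (R * star R) * star U := by
        have hker : N.ker ≤ (R * star R).ker := by
          rw [hN.ker_eq, ← ker_star_mul_self, star_star]
        rw [conj_eq_of_mul_star_mul_self_eq hN.isPartialIsometryOp hUN (.mul_star_self R) hker]
        simpa using hN.conj_star_mul_self.symm
    _ ≤ U * D ^ r * star U := by
        refine star_right_conjugate_le_conjugate ?_ U
        rw [hR, mul_rpow_half_mul_star C S hr0.le]
        exact h.conj_rpow_le hD hDS hr0 hr1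

theorem exists_isometries_sum_rpow_le {ι : Type*} [Fintype ι] {A : ι → H →L[ℂ] H}
    (hA : ∀ i, 0 ≤ A i) {r : ℝ} (hr0 : 0 < r) (hr1 : r ≤ 1) :
    ∃ U : ι → H →L[ℂ] H, (∀ i, IsIsometryOp (U i)) ∧
      (∑ i, A i) ^ r ≤ ∑ i, U i * A i ^ r * star (U i) := by
  have hS : 0 ≤ ∑ i, A i := Finset.sum_nonneg fun i _ => hA i
  have hAS : ∀ i, A i ≤ ∑ i, A i := fun i =>
    Finset.single_le_sum (fun j _ => hA j) (Finset.mem_univ i)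
  choose C hC using fun i => exists_isSqrtFactor (hA i) (hAS i)
  choose U hU hle using fun i => (hC i).exists_isometry_le (hA i) (hAS i) hr0 hr1
  refine ⟨U, hU, ?_⟩
  rw [← sum_star_mul_self_rpow hS hA rfl hC hr0]
  exact Finset.sum_le_sum fun i _ => hle i

end Subadditivity

section Eigenbasis

universe u

variable {H : Type*} [NormedAddCommGroup H] [InnerProductSpace ℂ H] {ι : Type*}

/-- The Hilbert basis `b` diagonalizes `B`, with the real numbers `β` on the diagonal. -/
def IsEigenbasis (b : HilbertBasis ι ℂ H) (β : ι → ℝ) (B : H →L[ℂ] H) : Prop :=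
  ∀ i, B (b i) = (β i : ℂ) • b i

namespace IsEigenbasis

variable {b : HilbertBasis ι ℂ H} {β : ι → ℝ} {B : H →L[ℂ] H}

theorem reApplyInnerSelf_apply (h : IsEigenbasis b β B) (i : ι) :
    B.reApplyInnerSelf (b i) = β i := by
  rw [ContinuousLinearMap.reApplyInnerSelf_apply, h i, inner_smul_left,
    inner_self_eq_norm_sq_to_K, b.orthonormal.1]
  simp

theorem nonneg (h : IsEigenbasis b β B) (hB : 0 ≤ B) (i : ι) : 0 ≤ β i :=
  h.reApplyInnerSelf_apply i ▸ reApplyInnerSelf_nonneg hB (b i)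

/-- A compact operator cannot keep the images of infinitely many basis vectors `c` apart. -/
theorem finite_setOf_le (h : IsEigenbasis b β B) (hBc : IsCompactOperator B) {c : ℝ}
    (hc : 0 < c) : {i | c ≤ β i}.Finite := by
  by_contra hinf
  let f := (show {i | c ≤ β i}.Infinite from hinf).natEmbedding
  obtain ⟨K, hK, hBK⟩ := hBc.image_closedBall_subset_compact (f := (B : H →ₗ[ℂ] H)) 1
  have hmem : ∀ n, B (b (f n)) ∈ K := fun n =>
    hBK ⟨b (f n), by simp [b.orthonormal.1], rfl⟩
  obtain ⟨_, -, φ, hφ, hlim⟩ := hK.tendsto_subseq hmem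
  obtain ⟨N, hN⟩ := Metric.cauchySeq_iff.1 hlim.cauchySeq c hc
  let i : ι := (f (φ N)).1
  let j : ι := (f (φ (N + 1))).1
  have hij : i ≠ j := fun hij =>
    (hφ (Nat.lt_succ_self N)).ne (f.injective (Subtype.ext hij))
  have hinner : inner ℂ (b i) (B (b i) - B (b j)) = (β i : ℂ) := by
    rw [inner_sub_right, h, h, inner_smul_right, inner_smul_right, b.orthonormal.2 hij,
      inner_self_eq_norm_sq_to_K, b.orthonormal.1]
    simp
  have hle := norm_inner_le_norm (𝕜 := ℂ) (b i) (B (b i) - B (b j))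
  rw [hinner, b.orthonormal.1, one_mul, Complex.norm_real] at hle
  have hlt : ‖B (b i) - B (b j)‖ < c := by
    rw [← dist_eq_norm]
    exact hN N le_rfl (N + 1) N.le_succ
  exact absurd hlt (not_lt.2 (((f (φ N)).2.trans (le_abs_self _)).trans hle))

theorem one (b : HilbertBasis ι ℂ H) : IsEigenbasis b (fun _ => 1) 1 := fun i => by simp

variable [CompleteSpace H]

theorem rpow (h : IsEigenbasis b β B) (hB : 0 ≤ B) {r : ℝ} (hr : 0 ≤ r) :
    IsEigenbasis b (fun i => β i ^ r) (B ^ r) :=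
  fun i => rpow_apply_eigenvector hB (h i) hr

theorem hasSum_reApplyInnerSelf (h : IsEigenbasis b β B) (hB : IsSelfAdjoint B) (x : H) :
    HasSum (fun i => β i * ‖inner ℂ (b i) x‖ ^ 2) (B.reApplyInnerSelf x) := by
  have hterm : ∀ i, inner ℂ (B x) (b i) * inner ℂ (b i) x =
      ((β i * ‖inner ℂ (b i) x‖ ^ 2 : ℝ) : ℂ) := fun i => by
    rw [show inner ℂ (B x) (b i) = inner ℂ x (B (b i)) from hB.isSymmetric x (b i), h,
      inner_smul_right, mul_assoc, ← inner_conj_symm x (b i), ← Complex.normSq_eq_conj_mul_self,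
      Complex.normSq_eq_norm_sq, ← Complex.ofReal_mul]
  have hsum := b.hasSum_inner_mul_inner (B x) x
  simp only [hterm] at hsum
  have hre : HasSum _ (B.reApplyInnerSelf x) := Complex.hasSum_re hsum
  simpa only [Complex.ofReal_re] using hre

theorem mem_ker_iff (h : IsEigenbasis b β B) (hB : IsSelfAdjoint B) {x : H} :
    x ∈ B.ker ↔ ∀ i, β i ≠ 0 → inner ℂ (b i) x = 0 := by
  have hinner : ∀ i, inner ℂ (b i) (B x) = β i * inner ℂ (b i) x := fun i => by
    rw [show inner ℂ (b i) (B x) = inner ℂ (B (b i)) x from (hB.isSymmetric (b i) x).symm, h,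
      inner_smul_left, Complex.conj_ofReal]
  have hzero : B x = 0 ↔ ∀ i, inner ℂ (b i) (B x) = 0 := by
    rw [← b.repr.map_eq_zero_iff, lp.ext_iff, funext_iff]
    simp [HilbertBasis.repr_apply_apply]
  rw [LinearMap.mem_ker, coe_coe, hzero]
  simp [hinner, or_iff_not_imp_left]

end IsEigenbasis

theorem exists_isEigenbasis {H : Type u} [NormedAddCommGroup H] [InnerProductSpace ℂ H]
    [CompleteSpace H] {B : H →L[ℂ] H} (hB : IsSelfAdjoint B) (hBc : IsCompactOperator B) :
    ∃ (ι : Type u) (b : HilbertBasis ι ℂ H) (β : ι → ℝ), IsEigenbasis b β B := by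
  have hsymm : (B : H →ₗ[ℂ] H).IsSymmetric := hB.isSymmetric
  let E : ℂ → Submodule ℂ H := Module.End.eigenspace (B : H →ₗ[ℂ] H)
  have hcomplete : ∀ μ, CompleteSpace (E μ) := fun μ =>
    (isClosed_eigenspace B μ).completeSpace_coe
  choose w b _ using fun μ => exists_hilbertBasis ℂ (E μ)
  let v : (Σ μ, w μ) → H := fun a => b a.1 a.2
  have hv : Orthonormal ℂ v :=
    hsymm.orthogonalFamily_eigenspaces.orthonormal_sigma_orthonormal fun μ => (b μ).orthonormal
  have hspan : (Submodule.span ℂ (Set.range v))ᗮ = ⊥ := by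
    refine eq_bot_iff.2 fun x hx => ?_
    rw [← orthogonalComplement_iSup_eigenspaces_eq_bot hBc hsymm, ← Submodule.iInf_orthogonal,
      Submodule.mem_iInf]
    refine fun μ => (Submodule.orthogonalProjectionOnto_eq_zero_iff (K := E μ)).1 ?_
    rw [← (b μ).repr.map_eq_zero_iff]
    ext i
    rw [HilbertBasis.repr_apply_apply, Submodule.inner_orthogonalProjectionOnto_eq_of_mem_left]
    exact hx _ (Submodule.subset_span ⟨⟨μ, i⟩, rfl⟩)
  refine ⟨Σ μ, w μ, HilbertBasis.mkOfOrthogonalEqBot hv hspan, fun a => a.1.re, fun a => ?_⟩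
  have hva : Module.End.HasEigenvector (B : H →ₗ[ℂ] H) a.1 (v a) :=
    ⟨(b a.1 a.2).2, hv.ne_zero a⟩
  rw [HilbertBasis.coe_mkOfOrthogonalEqBot, Complex.conj_eq_iff_re.1
    (hsymm.conj_eigenvalue_eq_self (Module.End.hasEigenvalue_of_hasEigenvector hva))]
  exact hva.apply_eq_smul

end Eigenbasis

section MinMax

variable {H : Type*} [NormedAddCommGroup H] [InnerProductSpace ℂ H] {κ ι : Type*}

theorem exists_unit_vector_inner_eq_zero {f : κ → H} (hf : Orthonormal ℂ f) (e : ι → H)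
    {S : Finset κ} {R : Finset ι} (hlt : R.card < S.card) :
    ∃ x : H, ‖x‖ = 1 ∧ (∀ k ∉ S, inner ℂ (f k) x = 0) ∧ ∀ i ∈ R, inner ℂ (e i) x = 0 := by
  let L : (S → ℂ) →ₗ[ℂ] H := Fintype.linearCombination ℂ fun k : S => f k
  let M : (S → ℂ) →ₗ[ℂ] R → ℂ := LinearMap.pi fun i => (innerₛₗ ℂ (e i)) ∘ₗ L
  have hM : M.ker ≠ ⊥ := LinearMap.ker_ne_bot_of_finrank_lt (by simpa using hlt)
  obtain ⟨a, ha, ha0⟩ := (Submodule.ne_bot_iff _).1 hM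
  have hL0 : L a ≠ 0 := fun h0 => ha0 <| funext <| Fintype.linearIndependent_iff.1
    (hf.linearIndependent.comp _ Subtype.val_injective) a h0
  refine ⟨((‖L a‖⁻¹ : ℝ) : ℂ) • L a, ?_, fun k hk => ?_, fun i hi => ?_⟩
  · rw [norm_smul, Complex.norm_real, norm_inv, norm_norm,
      inv_mul_cancel₀ (norm_ne_zero_iff.2 hL0)]
  · have hLk : inner ℂ (f k) (L a) = 0 := by
      simp only [L, Fintype.linearCombination_apply, inner_sum, inner_smul_right]
      refine Finset.sum_eq_zero fun j _ => ?_
      have hkj : k ≠ j := fun hkj => hk (hkj ▸ j.2)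
      rw [hf.2 hkj, mul_zero]
    rw [inner_smul_right, hLk, mul_zero]
  · have hLi : inner ℂ (e i) (L a) = 0 := congrFun (LinearMap.mem_ker.1 ha) ⟨i, hi⟩
    rw [inner_smul_right, hLi, mul_zero]

variable [CompleteSpace H] {f : HilbertBasis κ ℂ H} {β : κ → ℝ} {e : HilbertBasis ι ℂ H}
  {μ : ι → ℝ} {B M : H →L[ℂ] H}

theorem hasSum_mul_norm_inner_sq (b : HilbertBasis ι ℂ H) {x : H} (hx : ‖x‖ = 1) (c : ℝ) :
    HasSum (fun i => c * ‖inner ℂ (b i) x‖ ^ 2) c := by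
  simpa [reApplyInnerSelf_one, hx] using
    ((IsEigenbasis.one b).hasSum_reApplyInnerSelf (.one _) x).mul_left c

namespace IsEigenbasis

theorem le_reApplyInnerSelf (h : IsEigenbasis f β B) (hB : IsSelfAdjoint B) {x : H}
    (hx : ‖x‖ = 1) {c : ℝ} (hc : ∀ k, inner ℂ (f k) x ≠ 0 → c ≤ β k) :
    c ≤ B.reApplyInnerSelf x := by
  refine hasSum_le (fun k => ?_) (hasSum_mul_norm_inner_sq f hx c)
    (h.hasSum_reApplyInnerSelf hB x)
  by_cases hk : inner ℂ (f k) x = 0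
  · simp [hk]
  · exact mul_le_mul_of_nonneg_right (hc k hk) (sq_nonneg _)

theorem reApplyInnerSelf_lt (h : IsEigenbasis e μ M) (hM : IsSelfAdjoint M) {x : H}
    (hx : ‖x‖ = 1) {d : ℝ} (hd : ∀ i, inner ℂ (e i) x ≠ 0 → μ i < d) :
    M.reApplyInnerSelf x < d := by
  obtain ⟨i, hi⟩ : ∃ i, inner ℂ (e i) x ≠ 0 := by
    by_contra! hall
    have hsum := hasSum_mul_norm_inner_sq e hx 1
    simp only [hall, norm_zero, ne_eq, OfNat.ofNat_ne_zero, not_false_eq_true, zero_pow,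
      mul_zero] at hsum
    exact zero_ne_one (hasSum_zero.unique hsum)
  refine hasSum_lt (i := i) (fun j => ?_)
    (mul_lt_mul_of_pos_right (hd i hi) (pow_pos (norm_pos_iff.2 hi) 2))
    (h.hasSum_reApplyInnerSelf hM x) (hasSum_mul_norm_inner_sq e hx d)
  by_cases hj : inner ℂ (e j) x = 0
  · simp [hj]
  · exact mul_le_mul_of_nonneg_right (hd j hj).le (sq_nonneg _)

/-- The counting step of the min-max principle. -/
theorem card_le_card (hf : IsEigenbasis f β B) (hB : IsSelfAdjoint B) (he : IsEigenbasis e μ M)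
    (hM : IsSelfAdjoint M) {c d : ℝ}
    (h : ∀ x, ‖x‖ = 1 → c ≤ B.reApplyInnerSelf x → d ≤ M.reApplyInnerSelf x) {S : Finset κ}
    (hS : ∀ k ∈ S, c ≤ β k) {R : Finset ι} (hR : ∀ i, d ≤ μ i → i ∈ R) : S.card ≤ R.card := by
  by_contra! hlt
  obtain ⟨x, hx, hxS, hxR⟩ := exists_unit_vector_inner_eq_zero f.orthonormal e hlt
  have hc : c ≤ B.reApplyInnerSelf x :=
    hf.le_reApplyInnerSelf hB hx fun k hk => hS k (not_imp_comm.1 (hxS k) hk)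
  have hd : M.reApplyInnerSelf x < d :=
    he.reApplyInnerSelf_lt hM hx fun i hi => not_le.1 fun hdi => hi (hxR i (hR i hdi))
  exact (h x hx hc).not_gt hd

theorem exists_injective_rpow_le (hf : IsEigenbasis f β B) (hB : 0 ≤ B)
    (he : IsEigenbasis e μ M) (hM : IsSelfAdjoint M) (hMc : IsCompactOperator M) {r : ℝ}
    (hr : 0 < r) (h : ∀ x, ‖x‖ = 1 → B.reApplyInnerSelf x ^ r ≤ M.reApplyInnerSelf x) :
    ∃ σ : {k // 0 < β k ^ r} → ι, Function.Injective σ ∧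
      ∀ k : {k // 0 < β k ^ r}, β k ^ r ≤ μ (σ k) := by
  classical
  have hfin : ∀ k : {k // 0 < β k ^ r}, {i | β k ^ r ≤ μ i}.Finite := fun k =>
    he.finite_setOf_le hMc k.2
  suffices hHall : ∀ S : Finset {k // 0 < β k ^ r},
      S.card ≤ (S.biUnion fun k => (hfin k).toFinset).card by
    obtain ⟨σ, hσ, hσμ⟩ := (Finset.all_card_le_biUnion_card_iff_exists_injective _).1 hHall
    exact ⟨σ, hσ, fun k => by simpa using hσμ k⟩
  intro S
  rcases S.eq_empty_or_nonempty with rfl | hne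
  · simp
  obtain ⟨k₀, hk₀, hmin⟩ := S.exists_min_image (fun k => β k) hne
  calc S.card = (S.map (Function.Embedding.subtype _)).card := (Finset.card_map _).symm
    _ ≤ (hfin k₀).toFinset.card := by
      refine hf.card_le_card hB.isSelfAdjoint he hM (c := β k₀) (d := β k₀ ^ r)
        (fun x hx hc => ?_) (fun k hk => ?_) (fun i hi => by simpa using hi)
      · exact (Real.rpow_le_rpow (hf.nonneg hB k₀) hc hr.le).trans (h x hx)
      · obtain ⟨j, hj, rfl⟩ := Finset.mem_map.1 hk
        exact hmin j hj
    _ ≤ (S.biUnion fun k => (hfin k).toFinset).card :=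
      Finset.card_le_card
        (Finset.subset_biUnion_of_mem (fun k => (hfin k).toFinset) hk₀)

end IsEigenbasis

end MinMax

section OrthonormalFamilies

variable {H : Type*} [NormedAddCommGroup H] [InnerProductSpace ℂ H] [CompleteSpace H]
  {J : Type*} {e f : J → H}

/-- The synthesis operator of an orthonormal family: the isometry from `ℓ²` carrying the standard
basis to the family. -/
noncomputable def orthonormalSynthesis (hf : Orthonormal ℂ f) :
    lp (fun _ : J => ℂ) 2 →L[ℂ] H :=
  hf.orthogonalFamily.linearIsometry.toContinuousLinearMap

theorem orthonormalSynthesis_single [DecidableEq J] (hf : Orthonormal ℂ f) (j : J) :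
    orthonormalSynthesis hf (lp.single 2 j 1) = f j := by
  have h := hf.orthogonalFamily.linearIsometry_apply_single (i := j) (1 : ℂ)
  exact h.trans (by simp)

theorem adjoint_orthonormalSynthesis_apply_self (hf : Orthonormal ℂ f)
    (z : lp (fun _ : J => ℂ) 2) :
    adjoint (orthonormalSynthesis hf) (orthonormalSynthesis hf z) = z :=
  congr($((norm_map_iff_adjoint_comp_self (orthonormalSynthesis hf)).1
    hf.orthogonalFamily.linearIsometry.norm_map) z)

theorem adjoint_orthonormalSynthesis_apply (hf : Orthonormal ℂ f) (x : H) (j : J) :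
    adjoint (orthonormalSynthesis hf) x j = inner ℂ (f j) x := by
  classical
  rw [← orthonormalSynthesis_single hf j, ← adjoint_inner_right, lp.inner_single_left]
  simp

theorem exists_isPartialIsometryOp_of_orthonormal (hf : Orthonormal ℂ f)
    (he : Orthonormal ℂ e) :
    ∃ V : H →L[ℂ] H, IsPartialIsometryOp V ∧ (∀ j, V (f j) = e j) ∧
      ∀ x, V x = 0 ↔ ∀ j, inner ℂ (f j) x = 0 := by
  classical
  let Φ := orthonormalSynthesis hf
  let Ψ := orthonormalSynthesis he
  have hΦ : ∀ z, adjoint Φ (Φ z) = z := adjoint_orthonormalSynthesis_apply_self hf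
  have hΨ : ∀ z, adjoint Ψ (Ψ z) = z := adjoint_orthonormalSynthesis_apply_self he
  refine ⟨Ψ ∘L adjoint Φ, ?_, fun j => ?_, fun x => ?_⟩
  · ext x
    simp [star_eq_adjoint, adjoint_comp, hΦ, hΨ]
  · rw [← orthonormalSynthesis_single hf j, ← orthonormalSynthesis_single he j,
      comp_apply, hΦ]
  · rw [comp_apply, map_eq_zero_iff Ψ (Function.LeftInverse.injective hΨ), lp.ext_iff,
      funext_iff]
    simp [Φ, adjoint_orthonormalSynthesis_apply]

end OrthonormalFamilies

section Superadditivity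

variable {H : Type*} [NormedAddCommGroup H] [InnerProductSpace ℂ H] [CompleteSpace H]

/-- The partial isometry `V`, with the support of `D` as its initial space, carries `D` to an
operator below `G`. -/
structure CarriesBelow (V D G : H →L[ℂ] H) : Prop where
  isPartialIsometryOp : IsPartialIsometryOp V
  ker_eq : V.ker = D.ker
  conj_le : V * D * star V ≤ G

namespace CarriesBelow

variable {N V D G : H →L[ℂ] H}

theorem ker_le_ker_star (h : CarriesBelow V D G) (hD : 0 ≤ D) : G.ker ≤ (star V).ker := by
  intro x hx
  have hVx : star V x ∈ D.ker := by
    have hDx := ker_le_of_le (star_right_conjugate_nonneg hD V) h.conj_le hx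
    have hform : (V * D * star V).reApplyInnerSelf x = 0 := by
      simp [reApplyInnerSelf_apply, show (V * D * star V) x = 0 from hDx]
    rw [reApplyInnerSelf_conj, ← CFC.rpow_one D, ← norm_rpow_half_apply_sq D zero_le_one] at hform
    rw [← ker_rpow hD (one_half_pos (α := ℝ))]
    simpa using hform
  rw [← h.ker_eq] at hVx
  have hV : star V * V * star V = star V := by
    simpa only [IsPartialIsometryOp, star_star] using h.isPartialIsometryOp.star
  rw [LinearMap.mem_ker, ← hV, mul_assoc]
  simp [show V (star V x) = 0 from hVx]

theorem comp (h : CarriesBelow V D G) (hD : 0 ≤ D) (hN : IsPartialIsometryOp N)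
    (hNG : N.ker ≤ G.ker) : CarriesBelow (N * V) D (N * G * star N) := by
  have hNV : star N * N * V = V := by
    simpa [mul_assoc] using
      congrArg star (hN.mul_star_mul_of_ker_le (hNG.trans (h.ker_le_ker_star hD)))
  refine ⟨?_, ?_, ?_⟩
  · calc N * V * star (N * V) * (N * V) = N * (V * star V * (star N * N * V)) := by
          simp only [star_mul, mul_assoc]
      _ = N * V := by rw [hNV, h.isPartialIsometryOp]
  · rw [← h.ker_eq]
    refine le_antisymm (fun x hx => ?_) fun x hx => ?_
    · rw [← hNV, mul_assoc]
      simp [show N (V x) = 0 from hx]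
    · simp [show V x = 0 from hx]
  · calc N * V * D * star (N * V) = N * (V * D * star V) * star N := by
          simp only [star_mul, mul_assoc]
      _ ≤ N * G * star N := star_right_conjugate_le_conjugate h.conj_le N

end CarriesBelow

theorem IsEigenbasis.exists_carriesBelow {κ ι : Type*} {f : HilbertBasis κ ℂ H} {δ : κ → ℝ}
    {e : HilbertBasis ι ℂ H} {μ : ι → ℝ} {D M : H →L[ℂ] H} (hf : IsEigenbasis f δ D)
    (hD : 0 ≤ D) (he : IsEigenbasis e μ M) (hM : 0 ≤ M) {σ : {k // 0 < δ k} → ι}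
    (hσ : Function.Injective σ) (hσμ : ∀ k : {k // 0 < δ k}, δ k ≤ μ (σ k)) :
    ∃ V, CarriesBelow V D M := by
  have hpos : ∀ k, δ k ≠ 0 ↔ 0 < δ k := fun k => (hf.nonneg hD k).lt_iff_ne'.symm
  obtain ⟨V, hV, hVf, hV0⟩ := exists_isPartialIsometryOp_of_orthonormal
    (f.orthonormal.comp (Subtype.val : {k // 0 < δ k} → κ) Subtype.val_injective)
    (e.orthonormal.comp σ hσ)
  refine ⟨V, hV, ?_, ?_⟩
  · ext x
    rw [hf.mem_ker_iff hD.isSelfAdjoint]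
    simpa [hpos] using hV0 x
  refine le_of_reApplyInnerSelf_le (hD.isSelfAdjoint.conjugate V) hM.isSelfAdjoint fun y => ?_
  have hD_sum := hf.hasSum_reApplyInnerSelf hD.isSelfAdjoint (star V y)
  have hsupp : Function.support (fun k => δ k * ‖inner ℂ (f k) (star V y)‖ ^ 2) ⊆
      {k | 0 < δ k} := fun k hk => (hpos k).1 (left_ne_zero_of_mul hk)
  rw [reApplyInnerSelf_conj]
  refine hasSum_le_inj σ hσ (fun i _ => mul_nonneg (he.nonneg hM i) (sq_nonneg _)) (fun k => ?_)
    ((hasSum_subtype_iff_of_support_subset hsupp).2 hD_sum)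
    (he.hasSum_reApplyInnerSelf hM.isSelfAdjoint y)
  have hinner : inner ℂ (f k.1) (star V y) = inner ℂ (e (σ k)) y := by
    rw [star_eq_adjoint, adjoint_inner_right]
    exact congrArg (inner ℂ · y) (hVf k)
  simp only [Function.comp_apply, hinner]
  exact mul_le_mul_of_nonneg_right (hσμ k) (sq_nonneg _)

theorem exists_carriesBelow_rpow {B M : H →L[ℂ] H} (hB : 0 ≤ B) (hBc : IsCompactOperator B)
    (hM : 0 ≤ M) (hMc : IsCompactOperator M) {r : ℝ} (hr : 0 < r)
    (h : ∀ x, ‖x‖ = 1 → B.reApplyInnerSelf x ^ r ≤ M.reApplyInnerSelf x) :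
    ∃ V, CarriesBelow V (B ^ r) M := by
  obtain ⟨κ, f, β, hf⟩ := exists_isEigenbasis hB.isSelfAdjoint hBc
  obtain ⟨ι, e, μ, he⟩ := exists_isEigenbasis hM.isSelfAdjoint hMc
  obtain ⟨σ, hσ, hσμ⟩ := hf.exists_injective_rpow_le hB he hM.isSelfAdjoint hMc hr h
  exact (hf.rpow hB hr.le).exists_carriesBelow CFC.rpow_nonneg he hM hσ hσμ

theorem IsSqrtFactor.exists_carriesBelow {C D S : H →L[ℂ] H} (h : IsSqrtFactor C D S)
    (hD : 0 ≤ D) (hS : 0 ≤ S) (hSc : IsCompactOperator S) {r : ℝ} (hr : 1 ≤ r) :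
    ∃ V, CarriesBelow V (D ^ r) (star (C * S ^ (r / 2)) * (C * S ^ (r / 2))) := by
  have hr0 : 0 < r := by linarith
  set R := C * S ^ (r / 2)
  have hRR : R * star R = C * S ^ r * star C := mul_rpow_half_mul_star C S hr0.le
  obtain ⟨V, hV⟩ : ∃ V, CarriesBelow V (D ^ r) (R * star R) := by
    refine exists_carriesBelow_rpow hD (h.isCompactOperator hD hS hSc) (mul_star_self_nonneg R)
      ?_ hr0 fun x hx => ?_
    · rw [hRR]
      exact ((isCompactOperator_rpow hS hSc hr).clm_comp C).comp_clm (star C)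
    · have hCx : ‖star C x‖ ≤ 1 := by
        simpa [hx] using
          (star C).le_of_opNorm_le (show ‖star C‖ ≤ 1 by simpa using h.norm_le_one) x
      rw [hRR, ← h.conj_eq hD hS, reApplyInnerSelf_conj, reApplyInnerSelf_conj]
      exact rpow_reApplyInnerSelf_le hS hr hCx
  obtain ⟨N, hN⟩ := exists_isPolarFactor (star R)
  have hNker : N.ker ≤ (R * star R).ker := by
    rw [hN.ker_eq, ← ker_star_mul_self, star_star]
  have hNR : N * (R * star R) * star N = star R * R := by
    simpa using hN.conj_star_mul_self
  exact ⟨N * V, hNR ▸ hV.comp CFC.rpow_nonneg hN.isPartialIsometryOp hNker⟩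

/-- The bound between quadratic forms is weaker than `(∑ i, A i) ^ r ≤ M`: the operator `M` to
which this is applied, a multiple of a sum of powers, need not dominate `(∑ i, A i) ^ r`. -/
theorem exists_isPartialIsometryOp_sum_rpow_le {ι : Type*} [Fintype ι] {A : ι → H →L[ℂ] H}
    (hA : ∀ i, 0 ≤ A i) (hSc : IsCompactOperator (∑ i, A i : H →L[ℂ] H)) {M : H →L[ℂ] H}
    (hM : 0 ≤ M) (hMc : IsCompactOperator M) {r : ℝ} (hr : 1 ≤ r)
    (h : ∀ x, ‖x‖ = 1 → (∑ i, A i).reApplyInnerSelf x ^ r ≤ M.reApplyInnerSelf x) :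
    ∃ U : ι → H →L[ℂ] H, (∀ i, IsPartialIsometryOp (U i) ∧ (U i).ker = (A i).ker) ∧
      ∑ i, U i * A i ^ r * star (U i) ≤ M := by
  have hr0 : 0 < r := by linarith
  set S := ∑ i, A i with hSdef
  have hS : 0 ≤ S := Finset.sum_nonneg fun i _ => hA i
  have hAS : ∀ i, A i ≤ S := fun i =>
    Finset.single_le_sum (fun j _ => hA j) (Finset.mem_univ i)
  choose C hC using fun i => exists_isSqrtFactor (hA i) (hAS i)
  let P : ι → H →L[ℂ] H := fun i => star (C i * S ^ (r / 2)) * (C i * S ^ (r / 2))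
  have hP : ∑ i, P i = S ^ r := sum_star_mul_self_rpow hS hA hSdef.symm hC hr0
  have hPle : ∀ i, P i ≤ S ^ r := fun i =>
    hP ▸ Finset.single_le_sum (f := P) (fun j _ => star_mul_self_nonneg _) (Finset.mem_univ i)
  choose V hV using fun i => (hC i).exists_carriesBelow (hA i) hS hSc hr
  obtain ⟨W, hW⟩ := exists_carriesBelow_rpow hS hSc hM hMc hr0 h
  have hWV : ∀ i, CarriesBelow (W * V i) (A i ^ r) (W * P i * star W) := fun i =>
    (hV i).comp CFC.rpow_nonneg hW.isPartialIsometryOp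
      (hW.ker_eq.le.trans (ker_le_of_le (star_mul_self_nonneg _) (hPle i)))
  refine ⟨fun i => W * V i, fun i => ⟨(hWV i).isPartialIsometryOp,
    (hWV i).ker_eq.trans (ker_rpow (hA i) hr0)⟩, ?_⟩
  calc ∑ i, W * V i * A i ^ r * star (W * V i) ≤ ∑ i, W * P i * star W :=
        Finset.sum_le_sum fun i _ => (hWV i).conj_le
    _ = W * S ^ r * star W := by rw [← hP, Finset.mul_sum, Finset.sum_mul]
    _ ≤ M := hW.conj_le

end Superadditivity

section AbsolutePowers

variable {H : Type*} [NormedAddCommGroup H] [InnerProductSpace ℂ H] {ι κ : Type*} [Fintype ι]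
  [Fintype κ]

theorem isCompactOperator_sum {A : ι → H →L[ℂ] H} (hA : ∀ i, IsCompactOperator (A i)) :
    IsCompactOperator (∑ i, A i : H →L[ℂ] H) :=
  Submodule.sum_mem (compactOperator (RingHom.id ℂ) H H) fun i _ => hA i

variable [CompleteSpace H]

theorem absPow_eq (X : H →L[ℂ] H) {p : ℝ} (hp : 0 < p) :
    absPow X p = (star X * X) ^ (p / 2) := by
  rw [absPow, CFC.abs, CFC.sqrt_eq_rpow,
    CFC.rpow_rpow_of_exponent_nonneg _ _ _ (by norm_num) hp.le (star_mul_self_nonneg X),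
    one_div_mul_eq_div]

theorem IsPartialIsometryOp.exists_isIsometricOnSupport {N X : H →L[ℂ] H}
    (hN : IsPartialIsometryOp N) (hNX : N.ker = X.ker) {r : ℝ} (hr : 0 < r) :
    ∃ U, IsIsometricOnSupport U X ∧
      U * (star X * X) ^ r * star U = N * (star X * X) ^ r * star N := by
  by_cases hfin : FiniteDimensional ℂ H
  · obtain ⟨U, hU, hUN⟩ := exists_isometry_extending_of_finiteDimensional hN
    have hUker : U.ker = ⊥ := by
      rw [← ker_star_mul_self, hU]
      exact LinearMap.ker_id
    refine ⟨U, ⟨hU.isPartialIsometryOp, hUker.le.trans bot_le, fun _ => hU⟩,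
      conj_eq_of_mul_star_mul_self_eq hN hUN CFC.rpow_nonneg.isSelfAdjoint ?_⟩
    rw [hNX, ker_rpow (star_mul_self_nonneg X) hr, ker_star_mul_self]
  · exact ⟨N, ⟨hN, hNX.le, fun h => absurd h hfin⟩, rfl⟩

theorem rpow_reApplyInnerSelf_sum_le {B : κ → H →L[ℂ] H} (hB : ∀ j, 0 ≤ B j) {r : ℝ}
    (hr : 1 ≤ r) {x : H} (hx : ‖x‖ ≤ 1) :
    (∑ j, B j).reApplyInnerSelf x ^ r ≤
      (((Fintype.card κ : ℝ) ^ (r - 1)) • ∑ j, B j ^ r).reApplyInnerSelf x := by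
  rw [reApplyInnerSelf_sum, reApplyInnerSelf_real_smul, reApplyInnerSelf_sum]
  calc (∑ j, (B j).reApplyInnerSelf x) ^ r
      ≤ (Fintype.card κ : ℝ) ^ (r - 1) * ∑ j, (B j).reApplyInnerSelf x ^ r :=
        Real.rpow_sum_le_const_mul_sum_rpow_of_nonneg Finset.univ hr fun j _ =>
          reApplyInnerSelf_nonneg (hB j) x
    _ ≤ (Fintype.card κ : ℝ) ^ (r - 1) * ∑ j, (B j ^ r).reApplyInnerSelf x := by
        gcongr with j
        exact rpow_reApplyInnerSelf_le (hB j) hr hx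

theorem exists_isIsometricOnSupport_sum_le {X : ι → H →L[ℂ] H} {Y : κ → H →L[ℂ] H}
    (hXY : ∑ i, star (X i) * X i = ∑ j, star (Y j) * Y j)
    (hc : IsCompactOperator (∑ i, star (X i) * X i : H →L[ℂ] H)) {p : ℝ} (hp : 2 ≤ p) :
    ∃ U : ι → H →L[ℂ] H, (∀ i, IsIsometricOnSupport (U i) (X i)) ∧
      ∑ i, U i * absPow (X i) p * star (U i) ≤
        ((Fintype.card κ : ℝ) ^ (p / 2 - 1)) • ∑ j, absPow (Y j) p := by
  have hp0 : 0 < p := by linarith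
  have hr : 1 ≤ p / 2 := by linarith
  have hB : ∀ j, 0 ≤ star (Y j) * Y j := fun j => star_mul_self_nonneg (Y j)
  have hBc : ∀ j, IsCompactOperator (star (Y j) * Y j) := fun j =>
    isCompactOperator_of_le (hB j) (Finset.single_le_sum (fun j _ => hB j) (Finset.mem_univ j))
      (hXY ▸ hc)
  obtain ⟨N, hN, hle⟩ := exists_isPartialIsometryOp_sum_rpow_le
    (M := ((Fintype.card κ : ℝ) ^ (p / 2 - 1)) • ∑ j, (star (Y j) * Y j) ^ (p / 2))
    (fun i => star_mul_self_nonneg (X i)) hc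
    (smul_nonneg (by positivity) (Finset.sum_nonneg fun j _ => CFC.rpow_nonneg))
    ((isCompactOperator_sum fun j => isCompactOperator_rpow (hB j) (hBc j) hr).smul _) hr
    fun x hx => hXY ▸ rpow_reApplyInnerSelf_sum_le hB hr hx.le
  choose U hU hUN using fun i => (hN i).1.exists_isIsometricOnSupport
    ((hN i).2.trans (ker_star_mul_self (X i))) (half_pos hp0)
  refine ⟨U, hU, ?_⟩
  simpa only [absPow_eq _ hp0, hUN] using hle

theorem exists_isIsometryOp_le_sum {X : ι → H →L[ℂ] H} {Y : κ → H →L[ℂ] H}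
    (hXY : ∑ i, star (X i) * X i = ∑ j, star (Y j) * Y j) {p : ℝ} (hp0 : 0 < p) (hp : p ≤ 2) :
    ∃ U : ι → H →L[ℂ] H, (∀ i, IsIsometryOp (U i)) ∧
      ((Fintype.card κ : ℝ) ^ (p / 2 - 1)) • ∑ j, absPow (Y j) p ≤
        ∑ i, U i * absPow (X i) p * star (U i) := by
  simp only [absPow_eq _ hp0]
  obtain ⟨U, hU, hle⟩ := exists_isometries_sum_rpow_le
    (fun i => star_mul_self_nonneg (X i)) (r := p / 2) (by positivity) (by linarith)
  refine ⟨U, hU, le_trans ?_ hle⟩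
  rw [hXY]
  exact card_rpow_smul_sum_rpow_le (fun j => star_mul_self_nonneg (Y j)) (by positivity)
    (by linarith)

end AbsolutePowers

theorem theorem1p7_general {H : Type*} [NormedAddCommGroup H] [InnerProductSpace ℂ H]
    [CompleteSpace H] {ι κ : Type*} [Fintype ι] [Fintype κ] {p : ℝ} (hp : 0 < p)
    {X : ι → (H →L[ℂ] H)} {Y : κ → (H →L[ℂ] H)} (hX : 2 ≤ p → ∀ i, IsCompactOperator (X i))
    (hXY : ∑ i, CFC.abs (X i) ^ 2 = ∑ j, CFC.abs (Y j) ^ 2) :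
    (2 ≤ p →
      (∃ U : ι → (H →L[ℂ] H), (∀ i, IsIsometricOnSupport (U i) (X i)) ∧
        ∑ i, U i * absPow (X i) p * star (U i) ≤
          ((Fintype.card κ : ℝ) ^ (p / 2 - 1)) • ∑ j, absPow (Y j) p) ∧
      (∃ V : κ → (H →L[ℂ] H), (∀ j, IsIsometricOnSupport (V j) (Y j)) ∧
        ∑ j, V j * absPow (Y j) p * star (V j) ≤
          ((Fintype.card ι : ℝ) ^ (p / 2 - 1)) • ∑ i, absPow (X i) p)) ∧
    (p ≤ 2 →
      (∃ U : ι → (H →L[ℂ] H), (∀ i, IsIsometryOp (U i)) ∧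
        ((Fintype.card κ : ℝ) ^ (p / 2 - 1)) • ∑ j, absPow (Y j) p ≤
          ∑ i, U i * absPow (X i) p * star (U i)) ∧
      (∃ V : κ → (H →L[ℂ] H), (∀ j, IsIsometryOp (V j)) ∧
        ((Fintype.card ι : ℝ) ^ (p / 2 - 1)) • ∑ i, absPow (X i) p ≤
          ∑ j, V j * absPow (Y j) p * star (V j))) := by
  simp only [sq, CFC.abs_mul_abs] at hXY
  refine ⟨fun h => ?_, fun h =>
    ⟨exists_isIsometryOp_le_sum hXY hp h, exists_isIsometryOp_le_sum hXY.symm hp h⟩⟩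
  have hc : IsCompactOperator (∑ i, star (X i) * X i : H →L[ℂ] H) :=
    isCompactOperator_sum fun i => (hX h i).clm_comp (star (X i))
  exact ⟨exists_isIsometricOnSupport_sum_le hXY hc h,
    exists_isIsometricOnSupport_sum_le hXY.symm (hXY ▸ hc) h⟩

theorem theorem1p7 {H : Type*} [NormedAddCommGroup H] [InnerProductSpace ℂ H] [CompleteSpace H]
    (p : ℝ) (hp : 0 < p) (s t : ℕ) (X : Fin s → (H →L[ℂ] H)) (Y : Fin t → (H →L[ℂ] H))
    (hX : ∀ i, IsSchatten p (X i)) (hY : ∀ j, IsSchatten p (Y j))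
    (hXY : ∑ i, CFC.abs (X i) ^ 2 = ∑ j, CFC.abs (Y j) ^ 2) :
    (2 ≤ p →
      (∃ U : Fin s → (H →L[ℂ] H), (∀ i, IsIsometricOnSupport (U i) (X i)) ∧
        ∑ i, U i * absPow (X i) p * star (U i) ≤
          ((t : ℝ) ^ (p / 2 - 1)) • ∑ j, absPow (Y j) p) ∧
      (∃ V : Fin t → (H →L[ℂ] H), (∀ j, IsIsometricOnSupport (V j) (Y j)) ∧
        ∑ j, V j * absPow (Y j) p * star (V j) ≤
          ((s : ℝ) ^ (p / 2 - 1)) • ∑ i, absPow (X i) p)) ∧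
    (p ≤ 2 →
      (∃ U : Fin s → (H →L[ℂ] H), (∀ i, IsIsometryOp (U i)) ∧
        ((t : ℝ) ^ (p / 2 - 1)) • ∑ j, absPow (Y j) p ≤
          ∑ i, U i * absPow (X i) p * star (U i)) ∧
      (∃ V : Fin t → (H →L[ℂ] H), (∀ j, IsIsometryOp (V j)) ∧
        ((s : ℝ) ^ (p / 2 - 1)) • ∑ i, absPow (X i) p ≤
          ∑ j, V j * absPow (Y j) p * star (V j))) := by
  simpa only [Fintype.card_fin] using theorem1p7_general hp (fun _ i => (hX i).1) hXY
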